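/- A weighted graph here is a finite simple undirected graph $G=(V,E)$ with positive real edge weights $w$; $\mathrm{dist}_G(u,v)$ is the least total weight of a path from $u$ to $v$ in $G$ ($\infty$ if there is none). An edge-subgraph is a subgraph on the same vertex set with the same weights. For positive integers $f,t$, an edge-subgraph $H$ of $G$ is an *$f$-faulty-degree ($f$-FD) $t$-spanner* of $G$ if for every set $F\subseteq E$ such that each vertex is incident to at most $f$ edges of $F$, and for all vertices $u,v$, $$\mathrm{dist}_{H\setminus F}(u,v)\le t\cdot \mathrm{dist}_{G\setminus F}(u,v).$$ **Theorem 6.1.** There is an absolute constant $c>0$ such that for all positive integers $n,k,f$, every $n$-vertex undirected weighted graph has an $f$-FD $(2k-1)$-spanner with at most $f^{1-1/k}\,n^{1+1/k}\,(ck)^k$ edges. -/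

import Mathlib

open scoped NNReal ENNReal

/-- The weighted distance between `u` and `v` in the graph `G` with edge weights `w`: the least
total weight of a `u`-`v` walk, and `∞` if there is no such walk. -/
noncomputable def weightedDist {V : Type*} (G : SimpleGraph V) (w : Sym2 V → ℝ≥0) (u v : V) :
    ℝ≥0∞ :=
  ⨅ p : G.Walk u v, (((p.edges.map w).sum : ℝ≥0) : ℝ≥0∞)

/-- `deg_F(x)`: the number of edges of `F` that are incident to `x`. -/
noncomputable def faultDegree {V : Type*} (F : Set (Sym2 V)) (x : V) : ℕ∞ :=
  {e | e ∈ F ∧ x ∈ e}.encard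

/-- `H` is an `f`-faulty-degree (FD) `t`-spanner of the graph `G` with edge weights `w`:
`H` is an edge-subgraph of `G` (same vertex set, same weights), and for every set `F` of edges of
`G` with `deg_F(x) ≤ f` for all vertices `x`, and all vertices `u`, `v`,
`dist_{H \ F}(u, v) ≤ t * dist_{G \ F}(u, v)`. -/
def IsFDSpanner {V : Type*} (f : ℕ) (t : ℝ≥0) (G : SimpleGraph V) (w : Sym2 V → ℝ≥0)
    (H : SimpleGraph V) : Prop :=
  H ≤ G ∧ ∀ F : Set (Sym2 V), F ⊆ G.edgeSet → (∀ x : V, faultDegree F x ≤ f) →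
    ∀ u v : V, weightedDist (H.deleteEdges F) w u v ≤ t * weightedDist (G.deleteEdges F) w u v

/-!
The spanner is the greedy one: go through the edges by increasing weight and keep an edge `uv` if
some admissible fault set `F` destroys all good replacements of `uv` among the edges kept so far
(`exists_greedy_spanner`). The fault set `F` found for `e = uv` then meets every walk from `u` to
`v` that consists of at most `2k - 1` earlier edges (`EdgeBlocking`), and it has at most `f` edges
at each vertex. It remains to show that this blocking property forces the graph `H` to be sparse.

Suppose `H` has `n` vertices and `m` edges, and let `D` be about `m / (2kn)`. Consider walks along
which the edges increase and each step uses one of the `D` edges at the current vertex that come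
next after the edge just used (`WindowStep`). Every dart has at most `D` successors and at most `D`
predecessors, and all but `nD` darts have exactly `D` successors; so, without any regularity
assumption on `H`, there are at least about `m * D ^ k` such walks with `k + 1` edges.

If two different walks of length `b ≤ k` run from `s` to `t` and end with different edges, the later
of these two edges, `l`, is the last edge of the closed walk formed by the two, so the fault set
`F l` meets one of them. It meets the walk of `l` itself rarely, as each vertex has at most `f`
edges in `F l` compared with `D` continuations; such walks are discarded. That it meets the other
walk, `W'`, is also rare: choose the final dart `e` that continues both walks, then `l`, then `W'`
backwards from `e`, with `f` instead of `D` choices in one step. Now the rest of the first walk has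
a prescribed start and a prescribed continuation `l`. Hence, if by induction the walks of length
`b - 1` that have not been discarded number at most `R` for each start and continuation, then those
of length `b` number `O(k f R)` on average, in the sense of a second moment bound
(`card_candidate_pairs_le`). Discarding the walks with `O(k ^ 2 f R)` or more companions, which is a
fraction `O(1 / k)` of all walks, keeps the induction going. Because monotone walks end with their
last edge, only prefixes of walks ever have to satisfy the induction hypothesis.

In the end a constant fraction of the walks of length `k` remains, and at most
`O(k ^ 2 f) ^ (k - 1)` of them for each of the `n` starts and each continuation, whence
`D ^ k ≤ 2 n (32 k ^ 2 f) ^ (k - 1)` (`degree_pow_le_of_chainBlocking`, `EdgeBlocking.degree_pow_le`)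
and `m = O(k ^ 3 f ^ (1 - 1 / k) n ^ (1 + 1 / k))` (`EdgeBlocking.ncard_edgeSet_le`).
-/

/-! ### Chains in a relation of bounded degree -/

section Chains

open Finset
open scoped Classical

variable {A V : Type*}

/-- The lists `d :: L` with `d ∈ S` and `L ∈ X d`. -/
noncomputable def consAll (S : Finset A) (X : A → Finset (List A)) : Finset (List A) :=
  S.biUnion fun d => (X d).image (List.cons d)

lemma mem_consAll {S : Finset A} {X : A → Finset (List A)} {L : List A} :
    L ∈ consAll S X ↔ ∃ d ∈ S, ∃ M ∈ X d, d :: M = L := by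
  simp [consAll]

lemma cons_mem_consAll {S : Finset A} {X : A → Finset (List A)} {d : A} {L : List A} :
    d :: L ∈ consAll S X ↔ d ∈ S ∧ L ∈ X d := by
  simp [consAll]

lemma card_consAll (S : Finset A) (X : A → Finset (List A)) :
    #(consAll S X) = ∑ d ∈ S, #(X d) := by
  rw [consAll, card_biUnion]
  · exact sum_congr rfl fun d _ => card_image_of_injective _ (List.cons_injective)
  · intro d _ d' _ hne
    rw [Function.onFun, disjoint_left]
    intro L hL hL'
    obtain ⟨M, -, rfl⟩ := mem_image.1 hL
    obtain ⟨M', -, h⟩ := mem_image.1 hL'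
    exact hne (List.cons.inj h).1.symm

lemma consAll_mono {S : Finset A} {X Y : A → Finset (List A)} (h : ∀ d, X d ⊆ Y d) :
    consAll S X ⊆ consAll S Y := by
  intro L hL
  obtain ⟨d, hd, M, hM, rfl⟩ := mem_consAll.1 hL
  exact cons_mem_consAll.2 ⟨hd, h d hM⟩

/-- The label `σ` of the first element of the chain whose elements, from last to first, are
`a :: L`. -/
def startOf (σ : A → V) : A → List A → V
  | a, [] => σ a
  | _, a :: L => startOf σ a L

variable [Fintype A]

/-- The predecessors of `e` under the relation `T`. -/
noncomputable def preds (T : A → A → Prop) (e : A) : Finset A := {d | T d e}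

lemma mem_preds {T : A → A → Prop} {d e : A} : d ∈ preds T e ↔ T d e := by simp [preds]

/-- The lists of length `b` that, read from last to first, form a `T`-chain which can be
continued by `e`. Lists are stored backwards, so that a prefix of a chain is a tail of a list. -/
noncomputable def chains (T : A → A → Prop) : ℕ → A → Finset (List A)
  | 0, _ => {[]}
  | b + 1, e => consAll (preds T e) (chains T b)

lemma card_chains_le {T : A → A → Prop} {D : ℕ} (hin : ∀ e, #(preds T e) ≤ D) (b : ℕ) (e : A) :
    #(chains T b e) ≤ D ^ b := by
  induction b generalizing e with
  | zero => simp [chains]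
  | succ b ih =>
    rw [chains, card_consAll, pow_succ']
    exact (sum_le_card_nsmul _ _ _ fun d _ => ih d).trans
      (by rw [smul_eq_mul]; exact Nat.mul_le_mul_right _ (hin e))

/-- If every element has at most `f` predecessors with property `P`, then few of the chains
contain an element with property `P`. -/
lemma card_chains_hit_le {T : A → A → Prop} {D f : ℕ} (hin : ∀ e, #(preds T e) ≤ D)
    (P : A → Prop) (hP : ∀ e, #{d ∈ preds T e | P d} ≤ f) (b : ℕ) (e : A) :
    D * #{L ∈ chains T b e | ∃ a ∈ L, P a} ≤ b * f * D ^ b := by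
  induction b generalizing e with
  | zero => simp [chains, filter_singleton]
  | succ b ih =>
    have hsub : {L ∈ chains T (b + 1) e | ∃ a ∈ L, P a} ⊆
        consAll {d ∈ preds T e | P d} (chains T b) ∪
          consAll (preds T e) (fun d => {L ∈ chains T b d | ∃ a ∈ L, P a}) := by
      intro L hL
      rw [mem_filter] at hL
      obtain ⟨hL, a, ha, hPa⟩ := hL
      obtain ⟨d, hd, M, hM, rfl⟩ := mem_consAll.1 hL
      rw [mem_union, cons_mem_consAll, cons_mem_consAll, mem_filter, mem_filter]
      rcases List.mem_cons.1 ha with rfl | ha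
      · exact Or.inl ⟨⟨hd, hPa⟩, hM⟩
      · exact Or.inr ⟨hd, hM, a, ha, hPa⟩
    have h1 : #(consAll {d ∈ preds T e | P d} (chains T b)) ≤ f * D ^ b := by
      rw [card_consAll]
      exact (sum_le_card_nsmul _ _ _ fun d _ => card_chains_le hin b d).trans
        (by rw [smul_eq_mul]; exact Nat.mul_le_mul_right _ (hP e))
    have h2 : D * #(consAll (preds T e) (fun d => {L ∈ chains T b d | ∃ a ∈ L, P a})) ≤
        D * (b * f * D ^ b) := by
      rw [card_consAll, mul_sum]
      exact (sum_le_card_nsmul _ _ _ fun d _ => ih d).trans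
        (by rw [smul_eq_mul]; exact Nat.mul_le_mul_right _ (hin e))
    calc _ ≤ D * (#(consAll {d ∈ preds T e | P d} (chains T b)) +
          #(consAll (preds T e) (fun d => {L ∈ chains T b d | ∃ a ∈ L, P a}))) :=
          Nat.mul_le_mul_left _ ((card_le_card hsub).trans (card_union_le _ _))
      _ ≤ D * (f * D ^ b) + D * (b * f * D ^ b) := by
          rw [mul_add]; exact add_le_add (Nat.mul_le_mul_left _ h1) h2
      _ = _ := by ring

/-! ### Selecting chains with few companions -/

/-- `good b e` is the family of selected chains of length `b` that `e` continues. A chain `d :: L`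
is selected if `L` is selected, no element of `L` is hit by `d`, and the number of chains which
pass these two tests and have the same start as `d :: L` is at most `R (b + 1)`. -/
noncomputable def good (T hit : A → A → Prop) (σ : A → V) (R : ℕ → ℕ) :
    ℕ → A → Finset (List A)
  | 0, _ => {[]}
  | b + 1, e =>
    let Q := consAll (preds T e) fun d => {L ∈ good T hit σ R b d | ∀ a ∈ L, ¬ hit d a}
    {L ∈ Q | #{M ∈ Q | startOf σ e M = startOf σ e L} ≤ R (b + 1)}

/-- The chains that pass the first two tests in the definition of `good`. -/
noncomputable def candidates (T hit : A → A → Prop) (σ : A → V) (R : ℕ → ℕ) (b : ℕ) (e : A) :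
    Finset (List A) :=
  consAll (preds T e) fun d => {L ∈ good T hit σ R b d | ∀ a ∈ L, ¬ hit d a}

variable {T hit : A → A → Prop} {σ : A → V} {R : ℕ → ℕ}

lemma good_succ (b : ℕ) (e : A) : good T hit σ R (b + 1) e =
    {L ∈ candidates T hit σ R b e |
      #{M ∈ candidates T hit σ R b e | startOf σ e M = startOf σ e L} ≤ R (b + 1)} := rfl

lemma good_subset_chains (b : ℕ) (e : A) : good T hit σ R b e ⊆ chains T b e := by
  induction b generalizing e with
  | zero => simp [good, chains]
  | succ b ih =>
    exact (filter_subset _ _).trans (consAll_mono fun d => (filter_subset _ _).trans (ih d))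

lemma candidates_subset_chains (b : ℕ) (e : A) :
    candidates T hit σ R b e ⊆ chains T (b + 1) e :=
  consAll_mono fun d => (filter_subset _ _).trans (good_subset_chains b d)

lemma card_good_start_le (b : ℕ) (e : A) (s : V) :
    #{L ∈ good T hit σ R (b + 1) e | startOf σ e L = s} ≤ R (b + 1) := by
  rcases eq_empty_or_nonempty {L ∈ good T hit σ R (b + 1) e | startOf σ e L = s} with h | ⟨L, hL⟩
  · simp [h]
  · obtain ⟨hL', rfl⟩ := mem_filter.1 hL
    rw [good_succ, mem_filter] at hL'
    exact (card_le_card (filter_subset_filter _ (filter_subset _ _))).trans hL'.2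

/-- Blocking property for pairs of chains of length at most `k` with a common start and a common
continuation: unless their last elements agree, one of these last elements hits some element
of the two chains. -/
def ChainBlocking (T hit : A → A → Prop) (σ : A → V) (k : ℕ) : Prop :=
  ∀ b e l l' L L', b + 1 ≤ k → l ∈ preds T e → l' ∈ preds T e → L ∈ chains T b l →
    L' ∈ chains T b l' → startOf σ l L = startOf σ l' L' → l = l' ∨
    (∃ a ∈ L, hit l a) ∨ (∃ a ∈ l' :: L', hit l a) ∨
    (∃ a ∈ L', hit l' a) ∨ ∃ a ∈ l :: L, hit l' a

/-- Second moment bound: pairs of candidates with common start and common continuation are few.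
Given one of the two and the last element of the other, the rest of the other is a selected chain
with prescribed start and continuation. -/
lemma card_candidate_pairs_le {D f k : ℕ} (hf : 0 < f) (hin : ∀ e, #(preds T e) ≤ D)
    (hhit : ∀ e l, #{d ∈ preds T e | hit l d} ≤ f) (hblock : ChainBlocking T hit σ k)
    {b : ℕ} (hbk : b + 2 ≤ k) (e : A) :
    #{p ∈ candidates T hit σ R (b + 1) e ×ˢ candidates T hit σ R (b + 1) e |
        startOf σ e p.1 = startOf σ e p.2} ≤
      4 * (b + 2) * f * R (b + 1) * D ^ (b + 2) := by
  set Q := candidates T hit σ R (b + 1) e with hQ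
  set C := chains T (b + 2) e with hC
  have hQC : Q ⊆ C := candidates_subset_chains _ _
  -- `U l L'`: the candidates with last element `l` and the same start as `L'`
  let U : A → List A → Finset (List A) := fun l L' => {L ∈ Q | L.head? = some l ∧
    startOf σ e L = startOf σ e L'}
  have hU : ∀ l L', #(U l L') ≤ R (b + 1) := by
    intro l L'
    have : U l L' ⊆ ({L ∈ good T hit σ R (b + 1) l | startOf σ l L = startOf σ e L'}).image
        (List.cons l) := by
      intro L hL
      simp only [U, mem_filter] at hL
      obtain ⟨hL, hh, hs⟩ := hL
      obtain ⟨d, hd, M, hM, rfl⟩ := mem_consAll.1 hL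
      obtain rfl : d = l := by simpa using hh
      exact mem_image_of_mem _ (mem_filter.2 ⟨(mem_filter.1 hM).1, hs⟩)
    exact (card_le_card this).trans (card_image_le.trans (card_good_start_le _ _ _))
  -- the pairs in which the last element `l` of one chain hits the other chain `L'`
  let Z : Finset (Σ _ : A, Σ _ : List A, List A) := (preds T e).sigma fun l =>
    ({L' ∈ C | ∃ a ∈ L', hit l a}).sigma fun L' => U l L'
  have hZ : #Z ≤ (b + 2) * f * D ^ (b + 2) * R (b + 1) := by
    rw [card_sigma]
    calc _ ≤ ∑ l ∈ preds T e, #{L' ∈ C | ∃ a ∈ L', hit l a} * R (b + 1) := by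
          refine sum_le_sum fun l _ => ?_
          rw [card_sigma]
          exact sum_le_card_nsmul _ _ _ fun L' _ => hU l L'
      _ = (∑ l ∈ preds T e, #{L' ∈ C | ∃ a ∈ L', hit l a}) * R (b + 1) := by rw [sum_mul]
      _ ≤ _ := by
          refine Nat.mul_le_mul_right _ ?_
          rcases Nat.eq_zero_or_pos D with rfl | hD
          · have : preds T e = ∅ := card_eq_zero.1 (Nat.le_zero.1 (hin e))
            simp [this]
          · refine Nat.le_of_mul_le_mul_left ?_ hD
            rw [mul_sum]
            refine (sum_le_card_nsmul _ _ _ fun l _ =>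
              card_chains_hit_le hin (hit l) (fun e => hhit e l) (b + 2) e).trans ?_
            rw [smul_eq_mul]
            exact Nat.mul_le_mul_right _ (hin e)
  let Y : Finset (Σ _ : List A, List A) := Q.sigma fun L' => {L ∈ Q | L.head? = L'.head? ∧
    startOf σ e L = startOf σ e L'}
  have hY : #Y ≤ D ^ (b + 2) * R (b + 1) := by
    rw [card_sigma]
    refine (sum_le_card_nsmul _ _ (R (b + 1)) fun L' hL' => ?_).trans ?_
    · obtain ⟨d, hd, M, hM, rfl⟩ := mem_consAll.1 hL'
      exact hU d (d :: M)
    · rw [smul_eq_mul]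
      exact Nat.mul_le_mul_right _ ((card_le_card hQC).trans (card_chains_le hin _ _))
  have hsub : {p ∈ Q ×ˢ Q | startOf σ e p.1 = startOf σ e p.2} ⊆
      Y.image (fun y => (y.2, y.1)) ∪
        (Z.image (fun z => (z.2.2, z.2.1)) ∪ Z.image (fun z => (z.2.1, z.2.2))) := by
    rintro ⟨L₁, L₂⟩ hp
    rw [mem_filter, mem_product] at hp
    obtain ⟨⟨h₁, h₂⟩, hs⟩ := hp
    dsimp only at h₁ h₂ hs
    obtain ⟨l, hl, L, hL, rfl⟩ := mem_consAll.1 h₁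
    obtain ⟨l', hl', L', hL', rfl⟩ := mem_consAll.1 h₂
    rw [mem_filter] at hL hL'
    have hl2 := hQC h₁
    have hl2' := hQC h₂
    rw [mem_union, mem_union]
    rcases hblock (b + 1) e l l' L L' hbk hl hl' (good_subset_chains _ _ hL.1)
      (good_subset_chains _ _ hL'.1) hs with rfl | ⟨a, ha, h⟩ | h | ⟨a, ha, h⟩ | h
    · refine Or.inl (mem_image.2 ⟨(⟨l :: L', l :: L⟩ : Σ _ : List A, List A), ?_, rfl⟩)
      simp only [Y, mem_sigma, mem_filter]
      exact ⟨h₂, h₁, rfl, hs⟩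
    · exact absurd h (hL.2 a ha)
    · refine Or.inr (Or.inl (mem_image.2 ⟨⟨l, l' :: L', l :: L⟩, ?_, rfl⟩))
      simp only [Z, U, mem_sigma, mem_filter]
      exact ⟨hl, ⟨hl2', h⟩, h₁, rfl, hs⟩
    · exact absurd h (hL'.2 a ha)
    · refine Or.inr (Or.inr (mem_image.2 ⟨⟨l', l :: L, l' :: L'⟩, ?_, rfl⟩))
      simp only [Z, U, mem_sigma, mem_filter]
      exact ⟨hl', ⟨hl2, h⟩, h₂, rfl, hs.symm⟩
  calc _ ≤ #Y + (#Z + #Z) := (card_le_card hsub).trans ((card_union_le _ _).trans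
          (add_le_add card_image_le ((card_union_le _ _).trans
            (add_le_add card_image_le card_image_le))))
    _ ≤ D ^ (b + 2) * R (b + 1) + ((b + 2) * f * D ^ (b + 2) * R (b + 1) +
          (b + 2) * f * D ^ (b + 2) * R (b + 1)) := by gcongr
    _ ≤ ((b + 2) * f) * (D ^ (b + 2) * R (b + 1)) + ((b + 2) * f * D ^ (b + 2) * R (b + 1) +
          (b + 2) * f * D ^ (b + 2) * R (b + 1)) := by
        exact Nat.add_le_add_right (Nat.le_mul_of_pos_left _ (by positivity)) _
    _ = 3 * ((b + 2) * f * R (b + 1) * D ^ (b + 2)) := by ring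
    _ ≤ 4 * ((b + 2) * f * R (b + 1) * D ^ (b + 2)) := by gcongr; norm_num
    _ = _ := by ring

/-- A class of the partition by `g` with more than `r` members is seen more than `r` times by each
of its members in the count of pairs. -/
lemma card_large_fibres_mul_le {α β : Type*} (Q : Finset α) (g : α → β) (r : ℕ) :
    r * #{L ∈ Q | ¬ #{M ∈ Q | g M = g L} ≤ r} ≤ #{p ∈ Q ×ˢ Q | g p.1 = g p.2} := by
  have h : #{p ∈ Q ×ˢ Q | g p.1 = g p.2} = ∑ L ∈ Q, #{M ∈ Q | g M = g L} := by
    rw [card_filter, sum_product_right]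
    exact sum_congr rfl fun L _ => (card_filter _ _).symm
  rw [h, mul_comm, ← smul_eq_mul]
  exact (card_nsmul_le_sum _ _ r fun L hL => (not_le.1 (mem_filter.1 hL).2).le).trans
    (sum_le_sum_of_subset (filter_subset _ _))

/-- Few chains are lost because their last element hits an earlier one. -/
lemma sum_card_good_le_candidates {D f : ℕ} (hin : ∀ e, #(preds T e) ≤ D)
    (hhit : ∀ e l, #{d ∈ preds T e | hit l d} ≤ f) (b : ℕ) (e : A) :
    ∑ d ∈ preds T e, #(good T hit σ R b d) ≤
      #(candidates T hit σ R b e) + b * f * D ^ b := by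
  have h1 : ∀ d, #(good T hit σ R b d) ≤
      #{L ∈ good T hit σ R b d | ∀ a ∈ L, ¬ hit d a} +
        #{L ∈ chains T b d | ∃ a ∈ L, hit d a} := by
    intro d
    rw [← card_filter_add_card_filter_not (s := good T hit σ R b d)
      (fun L => ∀ a ∈ L, ¬ hit d a)]
    refine Nat.add_le_add_left (card_le_card fun L hL => ?_) _
    rw [mem_filter] at hL ⊢
    exact ⟨good_subset_chains _ _ hL.1, by simpa using hL.2⟩
  refine (sum_le_sum fun d _ => h1 d).trans ?_
  rw [sum_add_distrib, candidates, card_consAll]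
  gcongr
  rcases Nat.eq_zero_or_pos D with rfl | hD
  · have : preds T e = ∅ := card_eq_zero.1 (Nat.le_zero.1 (hin e))
    simp [this]
  · refine Nat.le_of_mul_le_mul_left ?_ hD
    rw [mul_sum]
    refine (sum_le_card_nsmul _ _ _ fun l _ =>
      card_chains_hit_le hin (hit l) (fun e => hhit e l) b l).trans ?_
    rw [smul_eq_mul]
    exact Nat.mul_le_mul_right _ (hin e)

/-- Few chains are lost because too many candidates share start and continuation with them: by the
second moment bound, raising the threshold by a factor `ρ` at each step makes this loss a fraction
of order `b * f / ρ`. -/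
lemma card_candidates_le {D f k ρ : ℕ} (hf : 0 < f) (hρ : 0 < ρ) (hin : ∀ e, #(preds T e) ≤ D)
    (hhit : ∀ e l, #{d ∈ preds T e | hit l d} ≤ f) (hblock : ChainBlocking T hit σ k)
    (hinj : ∀ e l l', T l e → T l' e → σ l = σ l' → l = l') {b : ℕ} (hbk : b + 1 ≤ k) (e : A) :
    ρ * #(candidates T hit σ (fun i => ρ ^ (i - 1)) b e) ≤
      ρ * #(good T hit σ (fun i => ρ ^ (i - 1)) (b + 1) e) + 4 * (b + 1) * f * D ^ (b + 1) := by
  rw [good_succ, ← card_filter_add_card_filter_not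
    (s := candidates T hit σ (fun i => ρ ^ (i - 1)) b e) (fun L =>
      #{M ∈ candidates T hit σ (fun i => ρ ^ (i - 1)) b e | startOf σ e M = startOf σ e L} ≤
        ρ ^ (b + 1 - 1)), mul_add]
  refine Nat.add_le_add_left ?_ _
  cases b with
  | zero =>
    -- a chain of length one is determined by its start and its continuation
    have : {L ∈ candidates T hit σ (fun i => ρ ^ (i - 1)) 0 e |
        ¬ #{M ∈ candidates T hit σ (fun i => ρ ^ (i - 1)) 0 e | startOf σ e M = startOf σ e L} ≤
          ρ ^ (0 + 1 - 1)} = ∅ := by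
      refine filter_eq_empty_iff.2 fun L _ h => h ?_
      rw [Nat.add_sub_cancel, pow_zero, card_le_one]
      intro M hM N hN
      rw [mem_filter] at hM hN
      have hs := hM.2.trans hN.2.symm
      obtain ⟨l, hl, M, hM', rfl⟩ := mem_consAll.1 hM.1
      obtain ⟨l', hl', N, hN', rfl⟩ := mem_consAll.1 hN.1
      obtain rfl : M = [] := by simpa [good] using (mem_filter.1 hM').1
      obtain rfl : N = [] := by simpa [good] using (mem_filter.1 hN').1
      rw [hinj e l l' (mem_preds.1 hl) (mem_preds.1 hl') hs]
    rw [this, card_empty, mul_zero]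
    exact Nat.zero_le _
  | succ b =>
    have h1 := card_candidate_pairs_le (R := fun i => ρ ^ (i - 1)) (σ := σ) hf hin hhit hblock
      hbk e
    have h2 := (card_large_fibres_mul_le (candidates T hit σ (fun i => ρ ^ (i - 1)) (b + 1) e)
      (startOf σ e) (ρ ^ (b + 1 + 1 - 1))).trans h1
    simp only [Nat.add_sub_cancel] at h2 ⊢
    refine Nat.le_of_mul_le_mul_left ?_ (pow_pos hρ b)
    rw [← mul_assoc, ← pow_succ]
    exact h2.trans (le_of_eq (by ring))

/-- One more step loses only a small proportion of the selected chains. -/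
lemma sum_card_good_step {n D f k ρ : ℕ} (hf : 0 < f) (hρ : 0 < ρ)
    (hin : ∀ e, #(preds T e) ≤ D) (hout : #{d | #{e | T d e} < D} ≤ n * D)
    (hhit : ∀ e l, #{d ∈ preds T e | hit l d} ≤ f) (hblock : ChainBlocking T hit σ k)
    (hinj : ∀ e l l', T l e → T l' e → σ l = σ l' → l = l') {b : ℕ} (hbk : b + 1 ≤ k) :
    ρ * (D * ∑ d, #(good T hit σ (fun i => ρ ^ (i - 1)) b d)) ≤
      ρ * ∑ e, #(good T hit σ (fun i => ρ ^ (i - 1)) (b + 1) e) +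
        (ρ * (n * D * D ^ (b + 1)) + ρ * (Fintype.card A * (b * f * D ^ b)) +
          Fintype.card A * (4 * (b + 1) * f * D ^ (b + 1))) := by
  set g := good T hit σ (fun i => ρ ^ (i - 1)) with hg
  have h1 : D * ∑ d, #(g b d) ≤ ∑ d, #{e | T d e} * #(g b d) + n * D * D ^ (b + 1) := by
    have : ∀ d, D * #(g b d) ≤
        #{e | T d e} * #(g b d) + if #{e | T d e} < D then D ^ (b + 1) else 0 := by
      intro d
      split_ifs with h
      · refine le_add_left ?_
        rw [pow_succ']
        exact Nat.mul_le_mul_left _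
          ((card_le_card (good_subset_chains _ _)).trans (card_chains_le hin _ _))
      · rw [add_zero]
        exact Nat.mul_le_mul_right _ (not_lt.1 h)
    rw [mul_sum]
    refine (sum_le_sum fun d _ => this d).trans ?_
    rw [sum_add_distrib, ← sum_filter, sum_const, smul_eq_mul]
    gcongr
  have h2 : ∑ d, #{e | T d e} * #(g b d) = ∑ e, ∑ d ∈ preds T e, #(g b d) := by
    simp only [preds, card_filter, sum_mul, sum_filter]
    rw [sum_comm]
    exact sum_congr rfl fun _ _ => sum_congr rfl fun _ _ => by split_ifs <;> simp
  have h3 : ∑ e, ∑ d ∈ preds T e, #(g b d) ≤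
      ∑ e, #(candidates T hit σ (fun i => ρ ^ (i - 1)) b e) +
        Fintype.card A * (b * f * D ^ b) := by
    refine (sum_le_sum fun e _ => sum_card_good_le_candidates hin hhit b e).trans ?_
    rw [sum_add_distrib, sum_const, smul_eq_mul, card_univ]
  have h4 : ρ * ∑ e, #(candidates T hit σ (fun i => ρ ^ (i - 1)) b e) ≤
      ρ * ∑ e, #(g (b + 1) e) + Fintype.card A * (4 * (b + 1) * f * D ^ (b + 1)) := by
    rw [mul_sum, mul_sum]
    refine (sum_le_sum fun e _ => card_candidates_le hf hρ hin hhit hblock hinj hbk e).trans ?_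
    rw [sum_add_distrib, sum_const, smul_eq_mul, card_univ]
  calc _ ≤ ρ * (∑ e, #(candidates T hit σ (fun i => ρ ^ (i - 1)) b e) +
        Fintype.card A * (b * f * D ^ b) + n * D * D ^ (b + 1)) :=
        Nat.mul_le_mul_left _ (h1.trans (by rw [h2]; gcongr))
    _ = ρ * ∑ e, #(candidates T hit σ (fun i => ρ ^ (i - 1)) b e) +
        (ρ * (n * D * D ^ (b + 1)) + ρ * (Fintype.card A * (b * f * D ^ b))) := by ring
    _ ≤ _ := by linarith

/-- A relation with in-degrees at most `D`, out-degrees mostly at least `D`, and the blocking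
property cannot have large `D`: most chains of length `k` are selected, and selected chains are
few since their number is bounded for each start and continuation. -/
theorem degree_pow_le_of_chainBlocking [Fintype V] [Nonempty A] {D f k : ℕ} (hf : 0 < f)
    (hk : 0 < k) (hin : ∀ e, #(preds T e) ≤ D)
    (hout : #{d | #{e | T d e} < D} ≤ Fintype.card V * D)
    (hhit : ∀ e l, #{d ∈ preds T e | hit l d} ≤ f) (hblock : ChainBlocking T hit σ k)
    (hinj : ∀ e l l', T l e → T l' e → σ l = σ l' → l = l')
    (hD : 8 * k ^ 2 * f ≤ D) (hA : 4 * k * Fintype.card V * D ≤ Fintype.card A) :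
    D ^ k ≤ 2 * Fintype.card V * (32 * k ^ 2 * f) ^ (k - 1) := by
  set n := Fintype.card V
  set N := Fintype.card A with hN
  have hN0 : 0 < N := Fintype.card_pos
  set ρ := 32 * k ^ 2 * f with hρ'
  have hρ : 0 < ρ := by positivity
  have hD0 : 0 < D := lt_of_lt_of_le (by positivity) hD
  set g : ℕ → ℕ := fun b => ∑ e, #(good T hit σ (fun i => ρ ^ (i - 1)) b e) with hg
  have hlow : ∀ b, b ≤ k → 2 * k * (N * D ^ b) ≤ 2 * k * g b + b * (N * D ^ b) := by
    intro b
    induction b with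
    | zero => intro _; simp [hg, good, hN]
    | succ b ih =>
      intro hb
      have ih := ih (by omega)
      have hs := sum_card_good_step (σ := σ) hf hρ hin hout hhit hblock hinj hb
      change ρ * (D * g b) ≤ ρ * g (b + 1) + (ρ * (n * D * D ^ (b + 1)) +
        ρ * (N * (b * f * D ^ b)) + N * (4 * (b + 1) * f * D ^ (b + 1))) at hs
      have e1 : 4 * k * (n * D * D ^ (b + 1)) ≤ N * D ^ (b + 1) := by
        calc _ = 4 * k * n * D * D ^ (b + 1) := by ring
          _ ≤ _ := Nat.mul_le_mul_right _ hA
      have e2 : 8 * k * (N * (b * f * D ^ b)) ≤ N * D ^ (b + 1) := by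
        calc _ = 8 * k * b * f * (N * D ^ b) := by ring
          _ ≤ 8 * k * k * f * (N * D ^ b) := by gcongr; omega
          _ = 8 * k ^ 2 * f * (N * D ^ b) := by ring
          _ ≤ D * (N * D ^ b) := Nat.mul_le_mul_right _ hD
          _ = _ := by ring
      have e3 : 8 * k * (N * (4 * (b + 1) * f * D ^ (b + 1))) ≤ ρ * (N * D ^ (b + 1)) := by
        calc _ = 32 * k * (b + 1) * f * (N * D ^ (b + 1)) := by ring
          _ ≤ 32 * k * k * f * (N * D ^ (b + 1)) := by gcongr
          _ = _ := by rw [hρ']; ring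
      have hstep : 2 * k * (D * g b) ≤ 2 * k * g (b + 1) + N * D ^ (b + 1) := by
        refine Nat.le_of_mul_le_mul_left ?_ hρ
        have m1 := Nat.mul_le_mul_left ρ e1
        have m2 := Nat.mul_le_mul_left ρ e2
        have ms := Nat.mul_le_mul_left (8 * k) hs
        nlinarith
      have ih' := Nat.mul_le_mul_left D ih
      have : D * (N * D ^ b) = N * D ^ (b + 1) := by ring
      nlinarith
  have hup : g k ≤ N * (n * ρ ^ (k - 1)) := by
    obtain ⟨b, rfl⟩ : ∃ b, k = b + 1 := ⟨k - 1, by omega⟩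
    refine (sum_le_card_nsmul _ _ (n * ρ ^ (b + 1 - 1)) fun e _ => ?_).trans (by simp [hN])
    rw [card_eq_sum_card_fiberwise (f := startOf σ e) (t := univ) (by simp)]
    exact (sum_le_card_nsmul _ _ _ fun s _ => card_good_start_le b e s).trans (by simp [n])
  have := hlow k le_rfl
  refine Nat.le_of_mul_le_mul_left (c := k * N) ?_ (by positivity)
  have := Nat.mul_le_mul_left (2 * k) hup
  nlinarith

end Chains

/-! ### Windowed monotone walks in a graph with ordered edges -/

section Darts

open Finset
open scoped Classical

lemma SimpleGraph.Dart.edge_eq_snd_fst {V : Type*} {H : SimpleGraph V} (d : H.Dart) :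
    d.edge = s(d.snd, d.fst) := by
  rw [Sym2.eq_swap]; rfl

lemma SimpleGraph.Dart.edge_eq_fst_snd {V : Type*} {H : SimpleGraph V} (d : H.Dart) :
    d.edge = s(d.fst, d.snd) := rfl

lemma dart_eq_of_edge_eq_of_snd_eq {V : Type*} {H : SimpleGraph V} {d d' : H.Dart}
    (h : d.edge = d'.edge) (hs : d.snd = d'.snd) : d = d' := by
  rw [d.edge_eq_snd_fst, d'.edge_eq_snd_fst, hs] at h
  exact SimpleGraph.Dart.ext _ _ (Prod.ext (Sym2.congr_right.1 h) hs)

variable {V α : Type*} [Fintype V] [LinearOrder α]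

/-- The rank of `e` among the edges of `H` at the vertex `v`, for the order given by `key`. -/
noncomputable def edgeRank (H : SimpleGraph V) (key : Sym2 V → α) (v : V) (e : Sym2 V) : ℕ :=
  #{x | H.Adj v x ∧ key s(v, x) < key e}

/-- The dart `d'` can follow the dart `d` if it leaves from the vertex where `d` ends and its edge
is one of the `D` edges at this vertex that come next after the edge of `d`. -/
def WindowStep (H : SimpleGraph V) (key : Sym2 V → α) (D : ℕ) (d d' : H.Dart) : Prop :=
  d.snd = d'.fst ∧ edgeRank H key d'.fst d.edge < edgeRank H key d'.fst d'.edge ∧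
    edgeRank H key d'.fst d'.edge ≤ edgeRank H key d'.fst d.edge + D

variable {H : SimpleGraph V} {key : Sym2 V → α} {D : ℕ}

lemma edgeRank_mono {v : V} {e e' : Sym2 V} (h : key e ≤ key e') :
    edgeRank H key v e ≤ edgeRank H key v e' :=
  card_le_card fun x hx => by
    rw [mem_filter] at hx ⊢
    exact ⟨hx.1, hx.2.1, hx.2.2.trans_le h⟩

lemma edgeRank_lt {v x : V} {e : Sym2 V} (hx : H.Adj v x) (h : key s(v, x) < key e) :
    edgeRank H key v s(v, x) < edgeRank H key v e := by
  refine card_lt_card ⟨fun y hy => ?_, fun hsub => ?_⟩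
  · rw [mem_filter] at hy ⊢
    exact ⟨hy.1, hy.2.1, hy.2.2.trans h⟩
  · have : x ∈ ({y | H.Adj v y ∧ key s(v, y) < key s(v, x)} : Finset V) :=
      hsub (by simp [hx, h])
    simp at this

lemma edgeRank_lt_degree {v x : V} (hx : H.Adj v x) :
    edgeRank H key v s(v, x) < H.degree v := by
  rw [← H.card_neighborFinset_eq_degree]
  refine card_lt_card ⟨fun y hy => by simp_all, fun hsub => ?_⟩
  have : x ∈ ({y | H.Adj v y ∧ key s(v, y) < key s(v, x)} : Finset V) := hsub (by simp [hx])
  simp at this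

lemma eq_of_edgeRank_eq (hkey : Function.Injective key) {v x y : V} (hx : H.Adj v x)
    (hy : H.Adj v y) (h : edgeRank H key v s(v, x) = edgeRank H key v s(v, y)) : x = y := by
  rcases lt_trichotomy (key s(v, x)) (key s(v, y)) with hlt | heq | hlt
  · exact absurd h (edgeRank_lt hx hlt).ne
  · exact Sym2.congr_right.1 (hkey heq)
  · exact absurd h (edgeRank_lt hy hlt).ne'

lemma exists_edgeRank_eq (hkey : Function.Injective key) {v : V} {j : ℕ} (hj : j < H.degree v) :
    ∃ x, H.Adj v x ∧ edgeRank H key v s(v, x) = j := by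
  have himg : (H.neighborFinset v).image (fun x => edgeRank H key v s(v, x)) =
      range (H.degree v) := by
    refine eq_of_subset_of_card_le (fun i hi => ?_) ?_
    · obtain ⟨x, hx, rfl⟩ := mem_image.1 hi
      exact mem_range.2 (edgeRank_lt_degree (by simpa using hx))
    · rw [card_image_of_injOn, card_range, H.card_neighborFinset_eq_degree]
      intro x hx y hy h
      exact eq_of_edgeRank_eq hkey (by simpa using hx) (by simpa using hy) h
  obtain ⟨x, hx, h⟩ := mem_image.1 (himg ▸ mem_range.2 hj)
  exact ⟨x, by simpa using hx, h⟩

lemma card_preds_windowStep_le (hkey : Function.Injective key) (e : H.Dart) :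
    #(preds (WindowStep H key D) e) ≤ D := by
  have : #(Ico (edgeRank H key e.fst e.edge - D) (edgeRank H key e.fst e.edge)) ≤ D := by
    rw [Nat.card_Ico]; omega
  refine (card_le_card_of_injOn (fun d => edgeRank H key e.fst d.edge) ?_ ?_).trans this
  · intro d hd
    obtain ⟨-, h1, h2⟩ := mem_preds.1 hd
    exact mem_Ico.2 ⟨Nat.sub_le_iff_le_add.2 h2, h1⟩
  · intro d hd d' hd' h
    obtain ⟨h1, -⟩ := mem_preds.1 hd
    obtain ⟨h1', -⟩ := mem_preds.1 hd'
    have hs : d'.snd = d.snd := h1'.trans h1.symm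
    dsimp only at h
    rw [d.edge_eq_snd_fst, d'.edge_eq_snd_fst, ← h1, hs] at h
    have hf : d.fst = d'.fst := eq_of_edgeRank_eq hkey d.adj.symm (hs ▸ d'.adj.symm) h
    exact SimpleGraph.Dart.ext _ _ (Prod.ext hf hs.symm)

/-- Only the last `D` edges at a vertex have fewer than `D` successors there. -/
lemma card_few_successors_le (hkey : Function.Injective key) :
    #{d : H.Dart | #{e | WindowStep H key D d e} < D} ≤ Fintype.card V * D := by
  have hlate : ∀ d : H.Dart, #{e | WindowStep H key D d e} < D →
      H.degree d.snd ≤ edgeRank H key d.snd d.edge + D := by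
    intro d hd
    by_contra! hlt
    refine hd.not_ge ?_
    set r := edgeRank H key d.snd d.edge with hr
    have hex : ∀ j ∈ Ioc r (r + D), ∃ e : H.Dart, WindowStep H key D d e ∧
        edgeRank H key d.snd e.edge = j := by
      intro j hj
      rw [mem_Ioc] at hj
      obtain ⟨x, hx, hxj⟩ := exists_edgeRank_eq hkey (hj.2.trans_lt hlt)
      exact ⟨⟨(d.snd, x), hx⟩, ⟨rfl, hj.1.trans_eq hxj.symm, hxj.le.trans hj.2⟩, hxj⟩
    have : Nonempty H.Dart := ⟨d⟩
    choose! g hg using hex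
    have hc : #(Ioc r (r + D)) = D := by simp
    calc D = #(Ioc r (r + D)) := hc.symm
      _ ≤ _ := card_le_card_of_injOn g (fun j hj => by simpa using (hg j hj).1) fun i hi j hj h => by
        rw [← (hg i hi).2, ← (hg j hj).2, h]
  have hcard : #((univ : Finset V) ×ˢ range D) = Fintype.card V * D := by simp
  rw [← hcard]
  refine card_le_card_of_injOn
    (fun d : H.Dart => (d.snd, H.degree d.snd - 1 - edgeRank H key d.snd d.edge)) ?_ ?_
  · intro d hd
    have h1 := hlate d (by simpa using hd)
    have h2 : edgeRank H key d.snd d.edge < H.degree d.snd := by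
      rw [d.edge_eq_snd_fst]; exact edgeRank_lt_degree d.adj.symm
    simp only [coe_product, coe_univ, Set.mem_prod, Set.mem_univ, true_and, mem_coe, mem_range]
    omega
  · intro d _ d' _ h
    obtain ⟨hs, h⟩ := Prod.mk.inj h
    have h2 : edgeRank H key d.snd d.edge < H.degree d.snd := by
      rw [d.edge_eq_snd_fst]; exact edgeRank_lt_degree d.adj.symm
    have h2' : edgeRank H key d'.snd d'.edge < H.degree d'.snd := by
      rw [d'.edge_eq_snd_fst]; exact edgeRank_lt_degree d'.adj.symm
    rw [← hs] at h h2'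
    have h : edgeRank H key d.snd d.edge = edgeRank H key d.snd d'.edge := by omega
    rw [d.edge_eq_snd_fst, d'.edge_eq_snd_fst, ← hs] at h
    have hf := eq_of_edgeRank_eq hkey d.adj.symm (hs ▸ d'.adj.symm) h
    exact SimpleGraph.Dart.ext _ _ (Prod.ext hf hs)

lemma card_preds_windowStep_mem_le {f : ℕ} {F : Set (Sym2 V)} (hF : ∀ x, faultDegree F x ≤ f)
    (e : H.Dart) : #{d ∈ preds (WindowStep H key D) e | d.edge ∈ F} ≤ f := by
  have h1 : #{d ∈ preds (WindowStep H key D) e | d.edge ∈ F} ≤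
      #{x : Sym2 V | x ∈ F ∧ e.fst ∈ x} := by
    refine card_le_card_of_injOn SimpleGraph.Dart.edge ?_ ?_
    · intro d hd
      obtain ⟨hd, hdF⟩ := mem_filter.1 hd
      simp only [coe_filter, mem_univ, true_and, Set.mem_ofPred_eq]
      refine ⟨hdF, ?_⟩
      rw [← (mem_preds.1 hd).1, d.edge_eq_snd_fst]
      exact Sym2.mem_mk_left _ _
    · intro d hd d' hd' h
      exact dart_eq_of_edge_eq_of_snd_eq h ((mem_preds.1 (mem_filter.1 hd).1).1.trans
        (mem_preds.1 (mem_filter.1 hd').1).1.symm)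
  have h2 : ((#{x : Sym2 V | x ∈ F ∧ e.fst ∈ x} : ℕ) : ℕ∞) = faultDegree F e.fst := by
    rw [faultDegree, ← Set.encard_coe_eq_coe_finsetCard]
    simp
  have h3 := hF e.fst
  rw [← h2] at h3
  exact h1.trans (by exact_mod_cast h3)

lemma WindowStep.key_lt {d e : H.Dart} (h : WindowStep H key D d e) :
    key d.edge < key e.edge := by
  by_contra! hle
  exact (edgeRank_mono hle).not_gt h.2.1

lemma key_lt_of_mem_chains {b : ℕ} {e : H.Dart} {L : List H.Dart}
    (hL : L ∈ chains (WindowStep H key D) b e) : ∀ a ∈ L, key a.edge < key e.edge := by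
  induction b generalizing e L with
  | zero => simp_all [chains]
  | succ b ih =>
    obtain ⟨d, hd, M, hM, rfl⟩ := mem_consAll.1 hL
    have hlt := (mem_preds.1 hd).key_lt
    intro a ha
    rcases List.mem_cons.1 ha with rfl | ha
    · exact hlt
    · exact (ih hM a ha).trans hlt

lemma exists_walk_of_mem_chains {b : ℕ} {e : H.Dart} {L : List H.Dart}
    (hL : L ∈ chains (WindowStep H key D) b e) {u v : V}
    (hu : startOf (fun d : H.Dart => d.fst) e L = u) (hv : e.fst = v) :
    ∃ p : H.Walk u v, p.length = b ∧ ∀ x ∈ p.edges, ∃ a ∈ L, a.edge = x := by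
  induction b generalizing e L u v with
  | zero =>
    obtain rfl : L = [] := by simpa [chains] using hL
    obtain rfl : u = v := hu.symm.trans hv
    exact ⟨.nil, rfl, by simp⟩
  | succ b ih =>
    obtain ⟨d, hd, M, hM, rfl⟩ := mem_consAll.1 hL
    obtain ⟨p, hp, hpe⟩ := ih hM hu rfl
    have hde := (mem_preds.1 hd).1.trans hv
    have hadj : H.Adj d.fst v := hde ▸ d.adj
    refine ⟨p.concat hadj, by simp [hp], fun x hx => ?_⟩
    rw [SimpleGraph.Walk.edges_concat, List.concat_eq_append, List.mem_append,
      List.mem_singleton] at hx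
    rcases hx with hx | rfl
    · obtain ⟨a, ha, rfl⟩ := hpe x hx
      exact ⟨a, List.mem_cons_of_mem _ ha, rfl⟩
    · exact ⟨d, List.mem_cons_self, by rw [d.edge_eq_fst_snd, hde]⟩

/-- `F` assigns to every edge `uv` of `H` a set of edges that meets all `u`-`v` walks of length
at most `2 * k - 1` in `H` on which every edge comes before `uv`. -/
def EdgeBlocking (H : SimpleGraph V) (key : Sym2 V → α) (F : Sym2 V → Set (Sym2 V)) (k : ℕ) :
    Prop :=
  ∀ u v, H.Adj u v → ∀ p : H.Walk u v, p.length ≤ 2 * k - 1 →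
    (∀ x ∈ p.edges, key x < key s(u, v)) → ∃ x ∈ p.edges, x ∈ F s(u, v)

/-- Two monotone chains with the same start and the same end close up to a walk on which the later
of the two last edges is the maximum. -/
lemma EdgeBlocking.hit_of_key_le {F : Sym2 V → Set (Sym2 V)} {k : ℕ}
    (hF : EdgeBlocking H key F k) (hkey : Function.Injective key) {b : ℕ} {e l l' : H.Dart}
    {L L' : List H.Dart} (hbk : b + 1 ≤ k) (hl : l ∈ preds (WindowStep H key D) e)
    (hl' : l' ∈ preds (WindowStep H key D) e) (hL : L ∈ chains (WindowStep H key D) b l)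
    (hL' : L' ∈ chains (WindowStep H key D) b l')
    (hs : startOf (fun d : H.Dart => d.fst) l L = startOf (fun d : H.Dart => d.fst) l' L')
    (hle : key l'.edge ≤ key l.edge) :
    l = l' ∨ (∃ a ∈ L, a.edge ∈ F l.edge) ∨ ∃ a ∈ l' :: L', a.edge ∈ F l.edge := by
  have hle1 := (mem_preds.1 hl).1
  have hle1' := (mem_preds.1 hl').1
  rcases hle.eq_or_lt with heq | hlt
  · exact Or.inl (dart_eq_of_edge_eq_of_snd_eq (hkey heq.symm) (hle1.trans hle1'.symm))
  right
  obtain ⟨p, hp, hpe⟩ := exists_walk_of_mem_chains hL rfl rfl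
  obtain ⟨q, hq, hqe⟩ := exists_walk_of_mem_chains
    (show l' :: L' ∈ chains (WindowStep H key D) (b + 1) e from cons_mem_consAll.2 ⟨hl', hL'⟩)
    (u := startOf (fun d : H.Dart => d.fst) l L) hs.symm hle1.symm
  let r : H.Walk l.fst l.snd := p.reverse.append q
  have hr : ∀ x ∈ r.edges, (∃ a ∈ L, a.edge = x) ∨ ∃ a ∈ l' :: L', a.edge = x := by
    intro x hx
    simp only [r, SimpleGraph.Walk.edges_append, SimpleGraph.Walk.edges_reverse,
      List.mem_append, List.mem_reverse] at hx
    exact hx.imp (hpe x) (hqe x)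
  obtain ⟨x, hx, hxF⟩ := hF l.fst l.snd l.adj r
    (by simp only [r, SimpleGraph.Walk.length_append, SimpleGraph.Walk.length_reverse,
          hp, hq]; omega)
    (by
      intro x hx
      rw [← l.edge_eq_fst_snd]
      rcases hr x hx with ⟨a, ha, rfl⟩ | ⟨a, ha, rfl⟩
      · exact key_lt_of_mem_chains hL a ha
      · rcases List.mem_cons.1 ha with rfl | ha
        · exact hlt
        · exact (key_lt_of_mem_chains hL' a ha).trans hlt)
  rw [← l.edge_eq_fst_snd] at hxF
  rcases hr x hx with ⟨a, ha, rfl⟩ | ⟨a, ha, rfl⟩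
  · exact Or.inl ⟨a, ha, hxF⟩
  · exact Or.inr ⟨a, ha, hxF⟩

lemma EdgeBlocking.chainBlocking {F : Sym2 V → Set (Sym2 V)} {k : ℕ}
    (hF : EdgeBlocking H key F k) (hkey : Function.Injective key) :
    ChainBlocking (WindowStep H key D) (fun l a => a.edge ∈ F l.edge)
      (fun d : H.Dart => d.fst) k := by
  intro b e l l' L L' hbk hl hl' hL hL' hs
  rcases le_total (key l'.edge) (key l.edge) with h | h
  · rcases hF.hit_of_key_le hkey hbk hl hl' hL hL' hs h with h | h | h
    · exact Or.inl h
    · exact Or.inr (Or.inl h)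
    · exact Or.inr (Or.inr (Or.inl h))
  · rcases hF.hit_of_key_le hkey hbk hl' hl hL' hL hs.symm h with h | h | h
    · exact Or.inl h.symm
    · exact Or.inr (Or.inr (Or.inr (Or.inl h)))
    · exact Or.inr (Or.inr (Or.inr (Or.inr h)))

/-- An integral form of the size bound, for any window size `D` that is at most the average degree
divided by `4 * k`. -/
theorem EdgeBlocking.degree_pow_le {F : Sym2 V → Set (Sym2 V)} {f k : ℕ}
    (hF : EdgeBlocking H key F k) (hkey : Function.Injective key)
    (hdeg : ∀ e x, faultDegree (F e) x ≤ f) (hf : 0 < f) (hk : 0 < k)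
    (hne : 0 < H.edgeSet.ncard) (hD : 8 * k ^ 2 * f ≤ D)
    (hm : 2 * k * Fintype.card V * D ≤ H.edgeSet.ncard) :
    D ^ k ≤ 2 * Fintype.card V * (32 * k ^ 2 * f) ^ (k - 1) := by
  have hcard : Fintype.card H.Dart = 2 * H.edgeSet.ncard := by
    rw [H.dart_card_eq_twice_card_edges, ← SimpleGraph.coe_edgeFinset, Set.ncard_coe_finset]
  have : Nonempty H.Dart := Fintype.card_pos_iff.1 (by omega)
  refine degree_pow_le_of_chainBlocking (T := WindowStep H key D)
    (hit := fun l a => a.edge ∈ F l.edge) (σ := fun d : H.Dart => d.fst) hf hk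
    (card_preds_windowStep_le hkey) (card_few_successors_le hkey)
    (fun e l => card_preds_windowStep_mem_le (hdeg l.edge) e) (hF.chainBlocking hkey) ?_ hD
    (by rw [hcard]; linarith)
  intro e l l' h h' hs
  exact SimpleGraph.Dart.ext _ _ (Prod.ext hs (h.1.trans h'.1.symm))

end Darts

/-! ### The greedy spanner -/

section Greedy

variable {V : Type*} {w : Sym2 V → ℝ≥0}

lemma weightedDist_le_walk {G : SimpleGraph V} {u v : V} (p : G.Walk u v) :
    weightedDist G w u v ≤ (((p.edges.map w).sum : ℝ≥0) : ℝ≥0∞) :=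
  iInf_le _ p

lemma weightedDist_mono {G G' : SimpleGraph V} (h : G ≤ G') (u v : V) :
    weightedDist G' w u v ≤ weightedDist G w u v := by
  refine le_iInf fun p => ?_
  have := weightedDist_le_walk (w := w) (p.mapLe h)
  simpa using this

lemma weightedDist_triangle (G : SimpleGraph V) (u v x : V) :
    weightedDist G w u x ≤ weightedDist G w u v + weightedDist G w v x := by
  unfold weightedDist
  rw [ENNReal.iInf_add]
  refine le_iInf fun p => ?_
  rw [ENNReal.add_iInf]
  refine le_iInf fun q => (weightedDist_le_walk (p.append q)).trans ?_
  simp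

/-- It suffices to check the spanner inequality on edges. -/
lemma weightedDist_le_mul_of_adj {G H : SimpleGraph V} {t : ℝ≥0} (ht : t ≠ 0)
    (h : ∀ u v, G.Adj u v → weightedDist H w u v ≤ t * w s(u, v)) (u v : V) :
    weightedDist H w u v ≤ t * weightedDist G w u v := by
  rw [weightedDist.eq_def G, ENNReal.mul_iInf_of_ne (by simpa using ht) (by simp)]
  refine le_iInf fun p => ?_
  induction p with
  | nil =>
    refine (weightedDist_le_walk .nil).trans ?_
    simp
  | @cons a b c hadj p ih =>
    refine (weightedDist_triangle H a b c).trans ?_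
    simp only [SimpleGraph.Walk.edges_cons, List.map_cons, List.sum_cons, ENNReal.coe_add, mul_add]
    exact add_le_add (h _ _ hadj) ih

/-- The edges can be ordered by weight, with ties broken. -/
lemma exists_injective_key [Finite V] (w : Sym2 V → ℝ≥0) :
    ∃ (N : ℕ) (key : Sym2 V → ℝ≥0 ×ₗ Fin N), Function.Injective key ∧
      ∀ e e', key e < key e' → w e ≤ w e' := by
  obtain ⟨N, ⟨φ⟩⟩ := Finite.exists_equiv_fin (Sym2 V)
  refine ⟨N, fun e => toLex (w e, φ e), fun e e' h => ?_, fun e e' h => ?_⟩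
  · exact φ.injective (Prod.mk.inj (toLex.injective h)).2
  · rcases (Prod.Lex.toLex_lt_toLex).1 h with h | h
    · exact h.le
    · exact h.1.le

/-- The greedy algorithm: an edge is kept if, for some admissible fault set, the edges kept before
it do not yet connect its ends well enough. The fault set which witnessed that an edge was needed
meets all short walks of earlier edges between the ends of this edge. -/
theorem exists_greedy_spanner [Fintype V] (f k : ℕ) (hk : 0 < k) (G : SimpleGraph V)
    (w : Sym2 V → ℝ≥0) :
    ∃ (N : ℕ) (key : Sym2 V → ℝ≥0 ×ₗ Fin N) (H : SimpleGraph V) (F : Sym2 V → Set (Sym2 V)),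
      Function.Injective key ∧ IsFDSpanner f ((2 * k - 1 : ℕ) : ℝ≥0) G w H ∧
      (∀ e x, faultDegree (F e) x ≤ f) ∧ EdgeBlocking H key F k := by
  obtain ⟨N, key, hkey, hw⟩ := exists_injective_key w
  set t : ℝ≥0 := ((2 * k - 1 : ℕ) : ℝ≥0) with ht
  have ht1 : 1 ≤ t := by
    rw [ht]; exact_mod_cast (by omega : 1 ≤ 2 * k - 1)
  have wf : WellFounded (fun e e' : Sym2 V => key e < key e') := by
    have : IsTrans (Sym2 V) (fun e e' : Sym2 V => key e < key e') := ⟨fun _ _ _ => lt_trans⟩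
    have : Std.Irrefl (fun e e' : Sym2 V => key e < key e') := ⟨fun _ => lt_irrefl _⟩
    exact Finite.wellFounded_of_trans_of_irrefl _
  -- `needed e S F`: under the faults `F`, the edges in `S` do not make up for `e`
  let needed : Sym2 V → Set (Sym2 V) → Set (Sym2 V) → Prop := fun e S F =>
    F ⊆ G.edgeSet ∧ (∀ x, faultDegree F x ≤ f) ∧ ∃ u v, e = s(u, v) ∧
      ¬ weightedDist ((SimpleGraph.fromEdgeSet S).deleteEdges F) w u v ≤ t * w e
  let keep : Sym2 V → Prop := wf.fix fun e ih =>
    e ∈ G.edgeSet ∧ ∃ F, needed e {x | ∃ h : key x < key e, ih x h} F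
  have hkeep : ∀ e, keep e ↔
      e ∈ G.edgeSet ∧ ∃ F, needed e {x | key x < key e ∧ keep x} F := by
    intro e
    have h : keep e = _ := wf.fix_eq _ e
    rw [h]
    simp only [exists_prop]
    rfl
  set H := SimpleGraph.fromEdgeSet {e | keep e} with hH
  have hHadj : ∀ {u v}, H.Adj u v ↔ keep s(u, v) := by
    intro u v
    rw [hH, SimpleGraph.fromEdgeSet_adj]
    exact ⟨fun h => h.1, fun h => ⟨h, G.ne_of_adj ((hkeep _).1 h).1⟩⟩
  have hHG : H ≤ G := fun u v h => ((hkeep _).1 (hHadj.1 h)).1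
  have hF : ∀ e, ∃ F : Set (Sym2 V), (∀ x, faultDegree F x ≤ f) ∧
      (keep e → needed e {x | key x < key e ∧ keep x} F) := by
    intro e
    by_cases he : keep e
    · obtain ⟨F, hF⟩ := ((hkeep e).1 he).2
      exact ⟨F, hF.2.1, fun _ => hF⟩
    · exact ⟨∅, by simp [faultDegree], fun h => absurd h he⟩
  choose F hFdeg hFneeded using hF
  refine ⟨N, key, H, F, hkey, ⟨hHG, fun F' hF'G hF' => ?_⟩, hFdeg, ?_⟩
  · refine weightedDist_le_mul_of_adj (by positivity) fun u v huv => ?_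
    rw [SimpleGraph.deleteEdges_adj] at huv
    by_cases he : keep s(u, v)
    · have hadj : (H.deleteEdges F').Adj u v :=
        SimpleGraph.deleteEdges_adj.2 ⟨hHadj.2 he, huv.2⟩
      refine (weightedDist_le_walk hadj.toWalk).trans ?_
      simp only [SimpleGraph.Walk.edges_cons, SimpleGraph.Walk.edges_nil, List.map_cons,
        List.map_nil, List.sum_cons, List.sum_nil, add_zero]
      exact_mod_cast le_mul_of_one_le_left (zero_le) ht1
    · have hle : weightedDist ((SimpleGraph.fromEdgeSet
          {x | key x < key s(u, v) ∧ keep x}).deleteEdges F') w u v ≤ t * w s(u, v) := by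
        by_contra hnot
        exact he ((hkeep _).2 ⟨huv.1, F', hF'G, hF', u, v, rfl, hnot⟩)
      exact (weightedDist_mono (SimpleGraph.deleteEdges_mono
        (SimpleGraph.fromEdgeSet_mono fun x hx => hx.2)) u v).trans hle
  · intro u v huv p hp hlt
    obtain ⟨-, -, a, b, hab, hnot⟩ := hFneeded _ (hHadj.1 huv)
    by_contra! hmiss
    refine hnot ?_
    have hkey' : ∀ q : H.Walk a b, q.length = p.length → (∀ x ∈ q.edges, x ∈ p.edges) →
        weightedDist ((SimpleGraph.fromEdgeSet
          {x | key x < key s(u, v) ∧ keep x}).deleteEdges (F s(u, v))) w a b ≤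
            t * w s(u, v) := by
      intro q hq hqp
      have hq' : ∀ x ∈ q.edges, x ∈ ((SimpleGraph.fromEdgeSet
          {x | key x < key s(u, v) ∧ keep x}).deleteEdges (F s(u, v))).edgeSet := by
        intro x hx
        have hxH := q.edges_subset_edgeSet hx
        rw [SimpleGraph.edgeSet_deleteEdges, SimpleGraph.edgeSet_fromEdgeSet]
        refine ⟨⟨⟨hlt x (hqp x hx), ?_⟩, H.not_isDiag_of_mem_edgeSet hxH⟩, hmiss x (hqp x hx)⟩
        rw [hH, SimpleGraph.edgeSet_fromEdgeSet] at hxH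
        exact hxH.1
      refine (weightedDist_le_walk (q.transfer _ hq')).trans ?_
      rw [SimpleGraph.Walk.edges_transfer]
      have hsum : (q.edges.map w).sum ≤ t * w s(u, v) := by
        refine (List.sum_le_card_nsmul _ (w s(u, v)) ?_).trans ?_
        · intro y hy
          obtain ⟨x, hx, rfl⟩ := List.mem_map.1 hy
          exact hw _ _ (hlt x (hqp x hx))
        · rw [List.length_map, SimpleGraph.Walk.length_edges, nsmul_eq_mul, hq]
          gcongr
          rw [ht]
          exact_mod_cast hp
      exact_mod_cast hsum
    rcases Sym2.eq_iff.1 hab with ⟨rfl, rfl⟩ | ⟨rfl, rfl⟩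
    · exact hkey' p rfl fun _ h => h
    · exact hkey' p.reverse (by simp) (by simp)

end Greedy

/-! ### The size bound -/

lemma mul_pow_three_le_pow {k : ℕ} (hk : 0 < k) :
    256 * (k : ℝ) ^ 3 ≤ (256 * (k : ℝ)) ^ k := by
  have hk1 : (1 : ℝ) ≤ k := by exact_mod_cast hk
  rcases (by omega : k = 1 ∨ k = 2 ∨ 3 ≤ k) with rfl | rfl | h3
  · norm_num
  · norm_num
  · calc 256 * (k : ℝ) ^ 3 ≤ (256 * (k : ℝ)) ^ 3 := by
          rw [mul_pow]; gcongr; norm_num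
      _ ≤ _ := pow_le_pow_right₀ (by linarith) h3

lemma EdgeBlocking.ncard_edgeSet_le {V α : Type*} [Fintype V] [LinearOrder α]
    {H : SimpleGraph V} {key : Sym2 V → α} {F : Sym2 V → Set (Sym2 V)} {f k : ℕ}
    (hF : EdgeBlocking H key F k) (hkey : Function.Injective key)
    (hdeg : ∀ e x, faultDegree (F e) x ≤ f) (hf : 0 < f) (hk : 0 < k)
    (hn : 0 < Fintype.card V) :
    (H.edgeSet.ncard : ℝ) ≤ (f : ℝ) ^ (1 - 1 / (k : ℝ)) *
      (Fintype.card V : ℝ) ^ (1 + 1 / (k : ℝ)) * (256 * (k : ℝ)) ^ k := by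
  classical
  set n := Fintype.card V with hn'
  set m := H.edgeSet.ncard with hm
  have hf0 : (0 : ℝ) < f := by exact_mod_cast hf
  have hn0 : (0 : ℝ) < n := by exact_mod_cast hn
  have hk0 : (0 : ℝ) < k := by exact_mod_cast hk
  have hk1 : (1 : ℝ) ≤ k := by exact_mod_cast hk
  set y : ℝ := (f : ℝ) ^ (1 - 1 / (k : ℝ)) * (n : ℝ) ^ (1 / (k : ℝ)) with hy
  have hy0 : 0 < y := by positivity
  have hyk : y ^ k = (f : ℝ) ^ (k - 1) * n := by
    rw [hy, mul_pow, ← Real.rpow_mul_natCast hf0.le, ← Real.rpow_mul_natCast hn0.le,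
      ← Real.rpow_natCast _ (k - 1), Nat.cast_sub hk]
    congr 1
    · congr 1; field_simp; simp
    · rw [one_div, inv_mul_cancel₀ hk0.ne', Real.rpow_one]
  have hgoal : (f : ℝ) ^ (1 - 1 / (k : ℝ)) * (n : ℝ) ^ (1 + 1 / (k : ℝ)) = n * y := by
    rw [Real.rpow_add hn0, Real.rpow_one, hy]; ring
  rw [hgoal]
  have hkk : k - 1 + 1 = k := by omega
  have h256 := mul_pow_three_le_pow hk
  suffices h : (m : ℝ) ≤ 256 * (k : ℝ) ^ 3 * (n * y) by
    refine h.trans ?_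
    rw [mul_comm]
    gcongr
  have hk3 : (1 : ℝ) ≤ (k : ℝ) ^ 3 := one_le_pow₀ hk1
  rcases le_total n f with hnf | hfn
  · -- with at least `n` faults per vertex the trivial bound `n ^ 2` is good enough
    have hny : (n : ℝ) ≤ y := by
      refine (pow_le_pow_iff_left₀ hn0.le hy0.le hk.ne').1 ?_
      rw [hyk, ← hkk, pow_succ, hkk]
      gcongr
    have hmn : (m : ℝ) ≤ n * n := by
      have h1 : m ≤ n.choose 2 := by
        rw [hm, ← SimpleGraph.coe_edgeFinset, Set.ncard_coe_finset]
        exact SimpleGraph.card_edgeFinset_le_card_choose_two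
      have h2 : n.choose 2 ≤ n * n := by
        rw [Nat.choose_two_right]
        exact (Nat.div_le_self _ _).trans (Nat.mul_le_mul_left _ (Nat.sub_le _ _))
      exact_mod_cast h1.trans h2
    calc (m : ℝ) ≤ n * n := hmn
      _ ≤ 1 * (n * y) := by rw [one_mul]; gcongr
      _ ≤ _ := by gcongr; linarith
  · have hfy : (f : ℝ) ≤ y := by
      refine (pow_le_pow_iff_left₀ hf0.le hy0.le hk.ne').1 ?_
      rw [hyk, ← hkk, pow_succ, hkk]
      gcongr
    set D := m / (2 * k * n) with hD
    have hkn : 0 < 2 * k * n := by positivity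
    have hmlt : m < 2 * k * n * (D + 1) := by
      rw [hD]; exact Nat.lt_mul_div_succ m hkn
    have hmltR : (m : ℝ) ≤ 2 * k * n * (D + 1) := by exact_mod_cast hmlt.le
    rcases lt_or_ge D (8 * k ^ 2 * f) with hDlt | hDge
    · have h1 : ((D : ℝ) + 1) ≤ 8 * (k : ℝ) ^ 2 * f := by exact_mod_cast hDlt
      calc (m : ℝ) ≤ 2 * k * n * (D + 1) := hmltR
        _ ≤ 2 * k * n * (8 * (k : ℝ) ^ 2 * y) := by
            gcongr
            exact h1.trans (by gcongr)
        _ = 16 * (k : ℝ) ^ 3 * (n * y) := by ring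
        _ ≤ _ := by gcongr; norm_num
    · have hD1 : 1 ≤ D := le_trans (Nat.succ_le_of_lt (by positivity)) hDge
      have hDm : 2 * k * n * D ≤ m := Nat.mul_div_le m _
      have hm0 : 0 < m := lt_of_lt_of_le (by positivity) hDm
      have hpow := hF.degree_pow_le hkey hdeg hf hk hm0 hDge hDm
      have hpowR : (D : ℝ) ^ k ≤ 2 * n * (32 * (k : ℝ) ^ 2 * f) ^ (k - 1) := by
        exact_mod_cast hpow
      have hDy : (D : ℝ) ≤ 64 * (k : ℝ) ^ 2 * y := by
        refine (pow_le_pow_iff_left₀ (by positivity) (by positivity) hk.ne').1 (hpowR.trans ?_)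
        have hk2 : (1 : ℝ) ≤ (k : ℝ) ^ 2 := one_le_pow₀ hk1
        calc 2 * (n : ℝ) * (32 * (k : ℝ) ^ 2 * f) ^ (k - 1)
            = 2 * (32 * (k : ℝ) ^ 2) ^ (k - 1) * ((f : ℝ) ^ (k - 1) * n) := by
              rw [mul_pow]; ring
          _ ≤ (64 * (k : ℝ) ^ 2) * (64 * (k : ℝ) ^ 2) ^ (k - 1) * ((f : ℝ) ^ (k - 1) * n) := by
              gcongr
              · linarith
              · norm_num
          _ = (64 * (k : ℝ) ^ 2 * y) ^ k := by
              rw [← pow_succ', hkk, mul_pow _ y, hyk]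
      have hD1R : (1 : ℝ) ≤ D := by exact_mod_cast hD1
      calc (m : ℝ) ≤ 2 * k * n * (D + 1) := hmltR
        _ ≤ 2 * k * n * (2 * (64 * (k : ℝ) ^ 2 * y)) := by gcongr; linarith
        _ = _ := by ring

theorem theorem6p1 :
    ∃ c : ℝ, 0 < c ∧
      ∀ n k f : ℕ, 0 < n → 0 < k → 0 < f →
        ∀ (V : Type*) [Fintype V], Fintype.card V = n →
          ∀ (G : SimpleGraph V) (w : Sym2 V → ℝ≥0), (∀ e ∈ G.edgeSet, 0 < w e) →
            ∃ H : SimpleGraph V,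
              IsFDSpanner f ((2 * k - 1 : ℕ) : ℝ≥0) G w H ∧
              (H.edgeSet.ncard : ℝ) ≤
                (f : ℝ) ^ (1 - 1 / (k : ℝ)) * (n : ℝ) ^ (1 + 1 / (k : ℝ)) * (c * (k : ℝ)) ^ k := by
  refine ⟨256, by norm_num, ?_⟩
  rintro n k f hn hk hf V _ rfl G w -
  obtain ⟨N, key, H, F, hkey, hspan, hdeg, hblock⟩ := exists_greedy_spanner f k hk G w
  exact ⟨H, hspan, hblock.ncard_edgeSet_le hkey hdeg hf hk hn⟩
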